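/- Let $\mathbb K$ be $\mathbb R$ or $\mathbb C$; Banach spaces are over $\mathbb K$, operators are continuous and linear, and $\mathfrak L(A,B)$ is the space of operators $A\to B$. For $n\ge 1$, an $n$-exact sequence between $Y$ and $X$ is an exact sequence of Banach spaces and operators $0\to Y\to E_1\to\cdots\to E_n\to X\to 0$. Two of them are equivalent if they are joined by a finite zigzag of commutative ladders which are the identity on $Y$ and on $X$. $\operatorname{Ext}^n(X,Y)$ is the collection of equivalence classes, with its usual linear structure: $\mathscr E+\mathscr F=\nabla(\mathscr E\oplus\mathscr F)\Delta$ (Baer sum: pushout along $\nabla(y,y')=y+y'$ and pullback along $\Delta(x)=(x,x)$), $c\,\mathscr E$ is the pushout of $\mathscr E$ along $c\,\mathbf I_Y$, and zero is the class of $0\to Y\to Y\oplus X\to X\to 0$ if $n=1$ and of $0\to Y=Y\to 0\to\cdots\to 0\to X=X\to 0$ if $n\ge 2$. A Banach space $\mathcal P$ is projective if every operator from $\mathcal P$ to a Banach space $F$ lifts through every surjective operator $E\to F$ from a Banach space $E$. For every Banach space $Z$ fix a short exact sequence $0\to\kappa(Z)\to\mathcal P(Z)\to Z\to 0$ with $\mathcal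 P(Z)$ projective. Put $\kappa^0(X)=X$, $\kappa^{k+1}(X)=\kappa(\kappa^k(X))$ and $\mathcal P_{k+1}=\mathcal P(\kappa^k(X))$, so that for every $k\ge 0$ there is a short exact sequence $$0\longrightarrow\kappa^{k+1}(X)\overset{\imath_{k+1}}\longrightarrow\mathcal P_{k+1}\longrightarrow\kappa^k(X)\longrightarrow 0.\qquad(\mathscr P_{k+1})$$ **Proposition.** Let $X$ and $Y$ be Banach spaces and $n\ge1$. Then $$\operatorname{Ext}^n(X,Y)=\operatorname{Ext}^{n-1}(\kappa(X),Y)=\cdots=\operatorname{Ext}^1(\kappa^{n-1}(X),Y)=\frac{\mathfrak L(\kappa^n(X),Y)}{\imath_n^*[\mathfrak L(\mathcal P_n,Y)]},$$ where $\imath_n^*(T)=T\imath_n$, in the following sense. (1) For $0\le k\le n-2$, splicing with $\mathscr P_{k+1}$, that is $[\mathscr E]\mapsto[\mathscr E\mathscr P_{k+1}]$, is a well-defined linear bijection $\operatorname{Ext}^{n-k-1}(\kappa^{k+1}(X),Y)\to\operatorname{Ext}^{n-k}(\kappa^k(X),Y)$. (2) The map sending $u\in\mathfrak L(\kappa^n(X),Y)$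 to the class of the pushout of $\mathscr P_n$ along $u$ induces a linear bijection from $\mathfrak L(\kappa^n(X),Y)/\imath_n^*[\mathfrak L(\mathcal P_n,Y)]$ onto $\operatorname{Ext}^1(\kappa^{n-1}(X),Y)$. -/

import Mathlib

universe u v

noncomputable section

namespace BanachExt

/-- A Banach space over `𝕜`, bundled. -/
structure Ban (𝕜 : Type v) [RCLike 𝕜] where
  carrier : Type u
  [normedAddCommGroup : NormedAddCommGroup carrier]
  [normedSpace : NormedSpace 𝕜 carrier]
  [completeSpace : CompleteSpace carrier]

attribute [instance] Ban.normedAddCommGroup Ban.normedSpace Ban.completeSpace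

instance {𝕜 : Type v} [RCLike 𝕜] : CoeSort (Ban.{u} 𝕜) (Type u) := ⟨Ban.carrier⟩

variable {𝕜 : Type v} [RCLike 𝕜]

/-- The direct sum of two Banach spaces (all the usual product norms are equivalent). -/
abbrev Ban.prod (A B : Ban.{u} 𝕜) : Ban.{u} 𝕜 := ⟨A × B⟩

/-- The zero Banach space. -/
abbrev Ban.zero (𝕜 : Type v) [RCLike 𝕜] : Ban.{u} 𝕜 := ⟨PUnit⟩

/-- First projection of a direct sum. -/
def Ban.fst (A B : Ban.{u} 𝕜) : A.prod B →L[𝕜] A := ContinuousLinearMap.fst 𝕜 A B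

/-- Second projection of a direct sum. -/
def Ban.snd (A B : Ban.{u} 𝕜) : A.prod B →L[𝕜] B := ContinuousLinearMap.snd 𝕜 A B

/-- First inclusion in a direct sum. -/
def Ban.inl (A B : Ban.{u} 𝕜) : A →L[𝕜] A.prod B := ContinuousLinearMap.inl 𝕜 A B

/-- The operator `(a, b) ↦ (f a, g b)` between direct sums. -/
def Ban.map {A B A' B' : Ban.{u} 𝕜} (f : A →L[𝕜] B) (g : A' →L[𝕜] B') :
    A.prod A' →L[𝕜] B.prod B' := ContinuousLinearMap.prodMap f g

/-- The diagonal operator `x ↦ (x, x)`. -/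
def Ban.diag (X : Ban.{u} 𝕜) : X →L[𝕜] X.prod X :=
  (ContinuousLinearMap.id 𝕜 X).prod (ContinuousLinearMap.id 𝕜 X)

/-- The sum operator `(y, y') ↦ y + y'`. -/
def Ban.sum (Y : Ban.{u} 𝕜) : Y.prod Y →L[𝕜] Y :=
  ContinuousLinearMap.fst 𝕜 Y Y + ContinuousLinearMap.snd 𝕜 Y Y

/-! ### Pushouts and pullbacks -/

/-- The closure of the subspace `Δ = {(α y, -β y) : y ∈ Y}` of `A ⊕ B`. -/
def pushoutRel {Y A B : Ban.{u} 𝕜} (α : Y →L[𝕜] A) (β : Y →L[𝕜] B) : Submodule 𝕜 (A × B) :=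
  (LinearMap.range (α.prod (-β)).toLinearMap).topologicalClosure

instance {Y A B : Ban.{u} 𝕜} (α : Y →L[𝕜] A) (β : Y →L[𝕜] B) :
    IsClosed (pushoutRel α β : Set (A × B)) :=
  Submodule.isClosed_topologicalClosure _

/-- The pushout space `(A ⊕ B) / closure Δ`. -/
abbrev PO {Y A B : Ban.{u} 𝕜} (α : Y →L[𝕜] A) (β : Y →L[𝕜] B) : Ban.{u} 𝕜 :=
  ⟨(A × B) ⧸ pushoutRel α β⟩

/-- The canonical operator `A → PO`. -/
def PO.inl {Y A B : Ban.{u} 𝕜} (α : Y →L[𝕜] A) (β : Y →L[𝕜] B) : A →L[𝕜] PO α β :=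
  (pushoutRel α β).mkQL.comp (ContinuousLinearMap.inl 𝕜 A B)

/-- The canonical operator `B → PO`. -/
def PO.inr {Y A B : Ban.{u} 𝕜} (α : Y →L[𝕜] A) (β : Y →L[𝕜] B) : B →L[𝕜] PO α β :=
  (pushoutRel α β).mkQL.comp (ContinuousLinearMap.inr 𝕜 A B)

theorem pushoutRel_le {Y A B C : Ban.{u} 𝕜} {α : Y →L[𝕜] A} {β : Y →L[𝕜] B}
    (a : A →L[𝕜] C) (b : B →L[𝕜] C) (h : ∀ y, a (α y) = b (β y)) :
    pushoutRel α β ≤ LinearMap.ker (a.coprod b).toLinearMap := by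
  refine Submodule.topologicalClosure_minimal _ ?_ (ContinuousLinearMap.isClosed_ker (a.coprod b))
  rintro _ ⟨y, rfl⟩
  simp [h]

/-- The operator `PO → C` given by the universal property. -/
def PO.desc {Y A B C : Ban.{u} 𝕜} {α : Y →L[𝕜] A} {β : Y →L[𝕜] B}
    (a : A →L[𝕜] C) (b : B →L[𝕜] C) (h : ∀ y, a (α y) = b (β y)) : PO α β →L[𝕜] C :=
  (pushoutRel α β).liftQL (a.coprod b) (pushoutRel_le a b h)

theorem PO.exists_rep {Y A B : Ban.{u} 𝕜} {α : Y →L[𝕜] A} {β : Y →L[𝕜] B} (z : PO α β) :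
    ∃ a b, z = PO.inl α β a + PO.inr α β b := by
  obtain ⟨⟨a, b⟩, rfl⟩ := Submodule.Quotient.mk_surjective (pushoutRel α β) z
  refine ⟨a, b, ?_⟩
  change (Submodule.Quotient.mk (a, b) : (A × B) ⧸ pushoutRel α β) =
    Submodule.Quotient.mk ((a, 0) + (0, b))
  simp

theorem PO.desc_inl {Y A B C : Ban.{u} 𝕜} {α : Y →L[𝕜] A} {β : Y →L[𝕜] B}
    (a : A →L[𝕜] C) (b : B →L[𝕜] C) (h : ∀ y, a (α y) = b (β y)) (x : A) :
    PO.desc a b h (PO.inl α β x) = a x := by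
  change a.coprod b (x, 0) = a x
  simp

theorem PO.desc_inr {Y A B C : Ban.{u} 𝕜} {α : Y →L[𝕜] A} {β : Y →L[𝕜] B}
    (a : A →L[𝕜] C) (b : B →L[𝕜] C) (h : ∀ y, a (α y) = b (β y)) (x : B) :
    PO.desc a b h (PO.inr α β x) = b x := by
  change a.coprod b (0, x) = b x
  simp

theorem PO.condition {Y A B : Ban.{u} 𝕜} (α : Y →L[𝕜] A) (β : Y →L[𝕜] B) (y : Y) :
    PO.inl α β (α y) = PO.inr α β (β y) := by
  change (Submodule.Quotient.mk (α y, 0) : (A × B) ⧸ pushoutRel α β) =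
    Submodule.Quotient.mk (0, β y)
  rw [Submodule.Quotient.eq]
  exact Submodule.le_topologicalClosure _ ⟨y, by simp⟩

theorem PO.inr_injective {Y A B : Ban.{u} 𝕜} (α : Y →L[𝕜] A) (β : Y →L[𝕜] B)
    (hα : Function.Injective α) (hcl : IsClosed (Set.range α)) :
    Function.Injective (PO.inr α β) := by
  obtain ⟨K, hK⟩ := α.antilipschitz_of_injective_of_isClosed_range hα (by simpa using hcl)
  have hanti : AntilipschitzWith K (α.prod (-β)) := fun x y =>
    (hK x y).trans (mul_le_mul_right (le_max_left _ _) _)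
  have hclosed := hanti.isClosed_range (α.prod (-β)).uniformContinuous
  rw [injective_iff_map_eq_zero]
  intro b hb
  have hb' : ((0 : A), b) ∈ pushoutRel α β := (Submodule.Quotient.mk_eq_zero _).1 hb
  have hb2 : ((0 : A), b) ∈ closure (Set.range (α.prod (-β))) := hb'
  rw [hclosed.closure_eq] at hb2
  obtain ⟨y, hy⟩ := hb2
  have h1 : α y = 0 := congrArg Prod.fst hy
  have h2 : -β y = b := congrArg Prod.snd hy
  have h3 : y = 0 := hα (by simpa using h1)
  rw [← h2, h3]
  simp

/-- The closed subspace `{(b, a) : β b = α a}` of `B ⊕ A`. -/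
def pullbackSub {A B X : Ban.{u} 𝕜} (β : B →L[𝕜] X) (α : A →L[𝕜] X) : Submodule 𝕜 (B × A) :=
  LinearMap.ker (β.coprod (-α)).toLinearMap

instance {A B X : Ban.{u} 𝕜} (β : B →L[𝕜] X) (α : A →L[𝕜] X) :
    CompleteSpace (pullbackSub β α) :=
  (ContinuousLinearMap.isClosed_ker (β.coprod (-α))).completeSpace_coe

theorem mem_pullbackSub {A B X : Ban.{u} 𝕜} (β : B →L[𝕜] X) (α : A →L[𝕜] X) (p : B × A) :
    p ∈ pullbackSub β α ↔ β p.1 = α p.2 := by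
  simp [pullbackSub, LinearMap.mem_ker, ← sub_eq_add_neg, sub_eq_zero]

/-- The pullback space `{(b, a) : β b = α a}`. -/
abbrev PB {A B X : Ban.{u} 𝕜} (β : B →L[𝕜] X) (α : A →L[𝕜] X) : Ban.{u} 𝕜 :=
  ⟨pullbackSub β α⟩

/-- The projection `PB → B`. -/
def PB.fst {A B X : Ban.{u} 𝕜} (β : B →L[𝕜] X) (α : A →L[𝕜] X) : PB β α →L[𝕜] B :=
  (ContinuousLinearMap.fst 𝕜 B A).comp (pullbackSub β α).subtypeL

/-- The projection `PB → A`. -/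
def PB.snd {A B X : Ban.{u} 𝕜} (β : B →L[𝕜] X) (α : A →L[𝕜] X) : PB β α →L[𝕜] A :=
  (ContinuousLinearMap.snd 𝕜 B A).comp (pullbackSub β α).subtypeL

/-- The operator `C → PB` given by the universal property. -/
def PB.lift {A B C X : Ban.{u} 𝕜} {β : B →L[𝕜] X} {α : A →L[𝕜] X}
    (b : C →L[𝕜] B) (a : C →L[𝕜] A) (h : ∀ c, β (b c) = α (a c)) : C →L[𝕜] PB β α :=
  (b.prod a).codRestrict (pullbackSub β α) fun c => (mem_pullbackSub β α _).2 (h c)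

theorem PB.condition {A B X : Ban.{u} 𝕜} (β : B →L[𝕜] X) (α : A →L[𝕜] X) (z : PB β α) :
    β (PB.fst β α z) = α (PB.snd β α z) :=
  (mem_pullbackSub β α _).1 z.2

theorem PB.ext {A B X : Ban.{u} 𝕜} {β : B →L[𝕜] X} {α : A →L[𝕜] X} {z w : PB β α}
    (h₁ : PB.fst β α z = PB.fst β α w) (h₂ : PB.snd β α z = PB.snd β α w) : z = w :=
  Subtype.ext (Prod.ext h₁ h₂)

theorem PB.fst_lift {A B C X : Ban.{u} 𝕜} {β : B →L[𝕜] X} {α : A →L[𝕜] X}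
    (b : C →L[𝕜] B) (a : C →L[𝕜] A) (h : ∀ c, β (b c) = α (a c)) (c : C) :
    PB.fst β α (PB.lift b a h c) = b c := rfl

theorem PB.snd_lift {A B C X : Ban.{u} 𝕜} {β : B →L[𝕜] X} {α : A →L[𝕜] X}
    (b : C →L[𝕜] B) (a : C →L[𝕜] A) (h : ∀ c, β (b c) = α (a c)) (c : C) :
    PB.snd β α (PB.lift b a h c) = a c := rfl

/-! ### Exact sequences of finite length -/

/-- `Chain Y n f`, where `f : A → B`, is the type of exact sequences
`0 → Y → E₁ → ⋯ → Eₙ → B` with `n ≥ 1`, `Eₙ = A` and last arrow `f`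
(`f` is not required to be surjective). There are none for `n = 0`. -/
inductive Chain (Y : Ban.{u} 𝕜) : ℕ → {A B : Ban.{u} 𝕜} → (A →L[𝕜] B) → Type (max (u + 1) v)
  | start {E C : Ban.{u} 𝕜} (f : Y →L[𝕜] E) (g : E →L[𝕜] C)
      (inj : Function.Injective f) (exact : Function.Exact f g) : Chain Y 1 g
  | snoc {n : ℕ} {A B C : Ban.{u} 𝕜} {f : A →L[𝕜] B} (c : Chain Y n f) (g : B →L[𝕜] C)
      (exact : Function.Exact f g) : Chain Y (n + 1) g

/-- An `n`-exact sequence `0 → Y → E₁ → ⋯ → Eₙ → X → 0`. -/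
structure NExact (n : ℕ) (X Y : Ban.{u} 𝕜) where
  {last : Ban.{u} 𝕜}
  π : last →L[𝕜] X
  chain : Chain Y n π
  surj : Function.Surjective π

/-- Existence of a commutative ladder between two exact sequences of the same length,
with `φ` between the left ends and the prescribed operators `α`, `β`
between the last two terms. -/
def ChainHom {Y Y' : Ban.{u} 𝕜} (φ : Y →L[𝕜] Y') :
    {n : ℕ} → {A B A' B' : Ban.{u} 𝕜} → {f : A →L[𝕜] B} → {f' : A' →L[𝕜] B'} →
      Chain Y n f → Chain Y' n f' → (A →L[𝕜] A') → (B →L[𝕜] B') → Prop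
  | _, _, _, _, _, _, _, .start f g _ _, .start f' g' _ _, α, β =>
      (∀ y, α (f y) = f' (φ y)) ∧ ∀ e, β (g e) = g' (α e)
  | _, _, _, _, _, _, _, .snoc c g _, .snoc c' g' _, β, γ =>
      (∃ α, ChainHom φ c c' α β) ∧ ∀ b, γ (g b) = g' (β b)
  | _, _, _, _, _, _, _, _, _, _, _ => False

theorem ChainHom.id {Y : Ban.{u} 𝕜} {n : ℕ} {A B : Ban.{u} 𝕜} {f : A →L[𝕜] B}
    (c : Chain Y n f) : ChainHom (.id 𝕜 Y) c c (.id 𝕜 A) (.id 𝕜 B) := by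
  induction c with
  | start f g _ _ => exact ⟨fun _ => rfl, fun _ => rfl⟩
  | snoc c g _ ih => exact ⟨⟨_, ih⟩, fun _ => rfl⟩

theorem ChainHom.last {Y Y' : Ban.{u} 𝕜} {φ : Y →L[𝕜] Y'} {n : ℕ} {A B A' B' : Ban.{u} 𝕜}
    {f : A →L[𝕜] B} {f' : A' →L[𝕜] B'} {c : Chain Y n f} {c' : Chain Y' n f'}
    {α : A →L[𝕜] A'} {β : B →L[𝕜] B'} (h : ChainHom φ c c' α β) (a : A) :
    β (f a) = f' (α a) := by
  cases c with
  | start f g _ _ =>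
    cases c' with
    | start f' g' _ _ => exact h.2 a
    | snoc c' g' _ => exact h.elim
  | snoc c g _ =>
    cases c' with
    | start f' g' _ _ => exact h.elim
    | snoc c' g' _ => exact h.2 a

/-! ### Operations on exact sequences -/

/-- Change of the last arrow of `0 → Y → E₁ → ⋯ → A → B` without changing its kernel. -/
def Chain.changeLast {Y : Ban.{u} 𝕜} {n : ℕ} {A B B' : Ban.{u} 𝕜} {f : A →L[𝕜] B}
    (c : Chain Y n f) (f' : A →L[𝕜] B') (h : ∀ a, f' a = 0 ↔ f a = 0) : Chain Y n f' :=
  match c with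
  | .start e _ inj exact => .start e f' inj fun a => (h a).trans (exact a)
  | .snoc c _ exact => .snoc c f' fun a => (h a).trans (exact a)

theorem ChainHom.changeLast {Y Y' : Ban.{u} 𝕜} {φ : Y →L[𝕜] Y'} {n : ℕ}
    {A B C A' B' C' : Ban.{u} 𝕜} {f : A →L[𝕜] B} {f' : A' →L[𝕜] B'}
    {c : Chain Y n f} {c' : Chain Y' n f'} {α : A →L[𝕜] A'} {β : B →L[𝕜] B'}
    (h : ChainHom φ c c' α β) (g : A →L[𝕜] C) (hg : ∀ a, g a = 0 ↔ f a = 0)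
    (g' : A' →L[𝕜] C') (hg' : ∀ a, g' a = 0 ↔ f' a = 0) (γ : C →L[𝕜] C')
    (hγ : ∀ a, γ (g a) = g' (α a)) :
    ChainHom φ (c.changeLast g hg) (c'.changeLast g' hg') α γ := by
  cases c with
  | start e _ _ _ =>
    cases c' with
    | start e' _ _ _ => exact ⟨h.1, hγ⟩
    | snoc c' _ _ => exact h.elim
  | snoc c _ _ =>
    cases c' with
    | start e' _ _ _ => exact h.elim
    | snoc c' _ _ => exact ⟨h.1, hγ⟩

/-- A short exact sequence `0 → Y → E → X → 0`. -/
structure ShortExact (X Y : Ban.{u} 𝕜) where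
  mid : Ban.{u} 𝕜
  ι : Y →L[𝕜] mid
  π : mid →L[𝕜] X
  inj : Function.Injective ι
  exact : Function.Exact ι π
  surj : Function.Surjective π

/-- A short exact sequence, viewed as a `1`-exact sequence. -/
def ShortExact.toNExact {X Y : Ban.{u} 𝕜} (P : ShortExact X Y) : NExact 1 X Y where
  π := P.π
  chain := .start P.ι P.π P.inj P.exact
  surj := P.surj

namespace NExact

/-- There is a morphism `S ⟶ T` which is the identity at both ends. -/
def Hom {n : ℕ} {X Y : Ban.{u} 𝕜} (S T : NExact n X Y) : Prop :=
  ∃ α : S.last →L[𝕜] T.last, ChainHom (.id 𝕜 Y) S.chain T.chain α (.id 𝕜 X)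

/-- The splicing of `0 → Y → E₁ → ⋯ → Eₙ → Z → 0` and `0 → Z → F → X → 0`, that is,
`0 → Y → E₁ → ⋯ → Eₙ → F → X → 0`. -/
def splice {n : ℕ} {X Y Z : Ban.{u} 𝕜} (S : NExact n Z Y) (P : ShortExact X Z) :
    NExact (n + 1) X Y where
  π := P.π
  chain := .snoc
    (S.chain.changeLast (P.ι.comp S.π) fun _ => map_eq_zero_iff P.ι P.inj) P.π <| by
      intro b
      rw [P.exact b]
      constructor
      · rintro ⟨z, rfl⟩
        obtain ⟨a, rfl⟩ := S.surj z
        exact ⟨a, rfl⟩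
      · rintro ⟨a, rfl⟩
        exact ⟨S.π a, rfl⟩
  surj := P.surj

theorem Hom.splice {n : ℕ} {X Y Z : Ban.{u} 𝕜} {S T : NExact n Z Y} (h : Hom S T)
    (P : ShortExact X Z) : Hom (S.splice P) (T.splice P) := by
  obtain ⟨α, h⟩ := h
  exact ⟨.id 𝕜 _, ⟨α, h.changeLast _ _ _ _ _ fun a => congrArg P.ι (h.last a)⟩, fun _ => rfl⟩

end NExact

/-- Pullback of `0 → Y → E₁ → ⋯ → Eₙ → X` along `α : A → X`, namely
`0 → Y → E₁ → ⋯ → PB → A`. -/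
def Chain.pull {Y : Ban.{u} 𝕜} {n : ℕ} {E X A : Ban.{u} 𝕜} {f : E →L[𝕜] X}
    (c : Chain Y n f) (α : A →L[𝕜] X) : Chain Y n (PB.snd f α) :=
  match c with
  | .start e f inj exact =>
    .start (PB.lift e 0 fun y => by simpa using (exact (e y)).2 ⟨y, rfl⟩) (PB.snd f α)
      (fun y y' h => inj (congrArg (PB.fst f α) h)) <| by
        intro z
        constructor
        · intro hz
          obtain ⟨y, hy⟩ := (exact (PB.fst f α z)).1 (by rw [PB.condition, hz, map_zero])
          exact ⟨y, PB.ext hy hz.symm⟩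
        · rintro ⟨y, rfl⟩
          rfl
  | .snoc (f := e) c f exact =>
    .snoc (c.changeLast (PB.lift (β := f) (α := α) e 0 fun y => by
            simpa using (exact (e y)).2 ⟨y, rfl⟩) fun y =>
          ⟨fun h => congrArg (PB.fst f α) h, fun h => PB.ext h rfl⟩)
      (PB.snd f α) <| by
        intro z
        constructor
        · intro hz
          obtain ⟨y, hy⟩ := (exact (PB.fst f α z)).1 (by rw [PB.condition, hz, map_zero])
          exact ⟨y, PB.ext hy hz.symm⟩
        · rintro ⟨y, rfl⟩
          rfl

theorem ChainHom.pull {Y : Ban.{u} 𝕜} {n : ℕ} {E E' X A : Ban.{u} 𝕜}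
    {f : E →L[𝕜] X} {f' : E' →L[𝕜] X} {c : Chain Y n f} {c' : Chain Y n f'} {β : E →L[𝕜] E'}
    (h : ChainHom (.id 𝕜 Y) c c' β (.id 𝕜 X)) (α : A →L[𝕜] X) :
    ∃ β', ChainHom (.id 𝕜 Y) (c.pull α) (c'.pull α) β' (.id 𝕜 A) := by
  refine ⟨PB.lift (β.comp (PB.fst f α)) (PB.snd f α) fun z => ?_, ?_⟩
  · rw [← PB.condition]
    exact (h.last _).symm
  cases c with
  | start e _ _ _ =>
    cases c' with
    | start e' _ _ _ => exact ⟨fun y => PB.ext (h.1 y) rfl, fun _ => rfl⟩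
    | snoc c' _ _ => exact h.elim
  | snoc c _ _ =>
    cases c' with
    | start e' _ _ _ => exact h.elim
    | snoc c' _ _ =>
      obtain ⟨⟨γ, hγ⟩, -⟩ := h
      exact ⟨⟨γ, hγ.changeLast _ _ _ _ _ fun a => PB.ext (hγ.last a) rfl⟩, fun _ => rfl⟩

/-- An exact sequence `0 → Y → E₁ → ⋯ → Eₙ → B` whose last arrow has the same range as `f`. -/
structure ChainRange (Y : Ban.{u} 𝕜) (n : ℕ) {A B : Ban.{u} 𝕜} (f : A →L[𝕜] B) where
  {last : Ban.{u} 𝕜}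
  map : last →L[𝕜] B
  chain : Chain Y n map
  range_eq : Set.range map = Set.range f

/-- Pushout of `0 → Y → E₁ → E₂ → ⋯ → Eₙ → C` along `β : Y → B`, namely
`0 → B → PO → E₂ → ⋯ → Eₙ → C`. -/
def Chain.push {Y B : Ban.{u} 𝕜} (β : Y →L[𝕜] B) : {n : ℕ} → {A C : Ban.{u} 𝕜} →
    {f : A →L[𝕜] C} → Chain Y n f → ChainRange B n f
  | _, _, _, _, .start f g inj exact =>
    have hfg : ∀ y, g (f y) = 0 := fun y => (exact (f y)).2 ⟨y, rfl⟩
    { map := PO.desc (α := f) (β := β) g 0 hfg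
      chain := .start (PO.inr f β) (PO.desc g 0 hfg)
        (PO.inr_injective f β inj <| by
          have : Set.range f = g ⁻¹' {0} := Set.ext fun x => (exact x).symm
          rw [this]
          exact isClosed_singleton.preimage g.continuous) <| by
        intro z
        obtain ⟨a, b, rfl⟩ := PO.exists_rep z
        rw [map_add, PO.desc_inl, PO.desc_inr]
        constructor
        · intro h
          obtain ⟨y, rfl⟩ := (exact a).1 (by simpa using h)
          exact ⟨β y + b, by rw [map_add, PO.condition]⟩
        · rintro ⟨b', h⟩
          have := congrArg (PO.desc g 0 hfg) h
          rw [map_add, PO.desc_inl, PO.desc_inr, PO.desc_inr] at this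
          exact this.symm
      range_eq := by
        ext c
        constructor
        · rintro ⟨z, rfl⟩
          obtain ⟨a, b, rfl⟩ := PO.exists_rep z
          rw [map_add, PO.desc_inl, PO.desc_inr]
          exact ⟨a, by simp⟩
        · rintro ⟨a, rfl⟩
          exact ⟨PO.inl f β a, PO.desc_inl _ _ _ _⟩ }
  | _, _, _, _, .snoc c g exact =>
    { map := g
      chain := .snoc (c.push β).chain g fun b => by
        rw [exact b, (c.push β).range_eq]
      range_eq := rfl }

theorem ChainHom.push {Y B : Ban.{u} 𝕜} (β : Y →L[𝕜] B) {n : ℕ} {A C : Ban.{u} 𝕜}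
    {f : A →L[𝕜] C} (c : Chain Y n f) : ∀ {A' C' : Ban.{u} 𝕜} {f' : A' →L[𝕜] C'}
    {c' : Chain Y n f'} {α : A →L[𝕜] A'} {γ : C →L[𝕜] C'}, ChainHom (.id 𝕜 Y) c c' α γ →
    ∃ α', ChainHom (.id 𝕜 B) (c.push β).chain (c'.push β).chain α' γ := by
  induction c with
  | start f g inj exact =>
    intro A' C' g' c' α γ h
    cases c' with
    | start f' _ inj' exact' =>
      have hαβ : ∀ y, ((PO.inl f' β).comp α) (f y) = PO.inr f' β (β y) := fun y => by
        change PO.inl f' β (α (f y)) = _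
        rw [h.1 y]
        exact PO.condition f' β y
      refine ⟨PO.desc ((PO.inl f' β).comp α) (PO.inr f' β) hαβ, ?_, ?_⟩
      · intro b
        exact PO.desc_inr _ _ _ b
      · intro z
        obtain ⟨a, b, rfl⟩ := PO.exists_rep z
        change γ (PO.desc g 0 (fun y => (exact (f y)).2 ⟨y, rfl⟩) (PO.inl f β a + PO.inr f β b)) =
          PO.desc g' 0 (fun y => (exact' (f' y)).2 ⟨y, rfl⟩)
            (PO.desc ((PO.inl f' β).comp α) (PO.inr f' β) hαβ (PO.inl f β a + PO.inr f β b))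
        have e₁ := PO.desc_inl ((PO.inl f' β).comp α) (PO.inr f' β) hαβ a
        have e₂ := PO.desc_inr ((PO.inl f' β).comp α) (PO.inr f' β) hαβ b
        rw [map_add, map_add, PO.desc_inl, PO.desc_inr, map_add, e₁, e₂, map_add,
          ContinuousLinearMap.comp_apply, PO.desc_inl, PO.desc_inr, h.2 a]
        simp
    | snoc c' _ _ => exact h.elim
  | snoc c g exact ih =>
    intro A' C' f' c' α γ h
    cases c' with
    | start e' _ _ _ => exact h.elim
    | snoc c' _ _ =>
      obtain ⟨⟨δ, hδ⟩, h⟩ := h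
      exact ⟨α, ih hδ, h⟩

theorem exact_map {A B C A' B' C' : Ban.{u} 𝕜} {f : A →L[𝕜] B} {g : B →L[𝕜] C}
    {f' : A' →L[𝕜] B'} {g' : B' →L[𝕜] C'} (h : Function.Exact f g) (h' : Function.Exact f' g') :
    Function.Exact (Ban.map f f') (Ban.map g g') := by
  rintro ⟨b, b'⟩
  constructor
  · intro hb
    obtain ⟨a, rfl⟩ := (h b).1 (congrArg Prod.fst hb)
    obtain ⟨a', rfl⟩ := (h' b').1 (congrArg Prod.snd hb)
    exact ⟨(a, a'), rfl⟩
  · rintro ⟨⟨a, a'⟩, e⟩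
    have e1 : f a = b := congrArg Prod.fst e
    have e2 : f' a' = b' := congrArg Prod.snd e
    exact Prod.ext ((h b).2 ⟨a, e1⟩) ((h' b').2 ⟨a', e2⟩)

/-- There are no exact sequences of length `0`. -/
theorem Chain.zero_false {Y : Ban.{u} 𝕜} {n : ℕ} {A B : Ban.{u} 𝕜} {f : A →L[𝕜] B}
    (c : Chain Y n f) (h : n = 0) : False := by
  cases c <;> omega

/-- The termwise direct sum of two exact sequences of the same length. -/
def Chain.dsum {Y Y' : Ban.{u} 𝕜} : {n : ℕ} → {A B A' B' : Ban.{u} 𝕜} → {f : A →L[𝕜] B} →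
    {f' : A' →L[𝕜] B'} → Chain Y n f → Chain Y' n f' → Chain (Y.prod Y') n (Ban.map f f')
  | _, _, _, _, _, _, _, .start f g inj exact, .start f' g' inj' exact' =>
    .start (Ban.map f f') (Ban.map g g') (Function.Injective.prodMap inj inj')
      (exact_map exact exact')
  | _, _, _, _, _, _, _, .snoc c g exact, .snoc c' g' exact' =>
    .snoc (c.dsum c') (Ban.map g g') (exact_map exact exact')
  | _, _, _, _, _, _, _, .start _ _ _ _, .snoc c _ _ => (c.zero_false rfl).elim
  | _, _, _, _, _, _, _, .snoc c _ _, .start _ _ _ _ => (c.zero_false rfl).elim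

theorem ChainHom.dsum {Y Y' Z Z' : Ban.{u} 𝕜} {φ : Y →L[𝕜] Z} {φ' : Y' →L[𝕜] Z'} {n : ℕ}
    {A B : Ban.{u} 𝕜} {f : A →L[𝕜] B} (c : Chain Y n f) :
    ∀ {C D A' B' C' D' : Ban.{u} 𝕜} {g : C →L[𝕜] D} {f' : A' →L[𝕜] B'} {g' : C' →L[𝕜] D'}
      {d : Chain Z n g} {c' : Chain Y' n f'} {d' : Chain Z' n g'} {α : A →L[𝕜] C}
      {β : B →L[𝕜] D} {α' : A' →L[𝕜] C'} {β' : B' →L[𝕜] D'},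
      ChainHom φ c d α β → ChainHom φ' c' d' α' β' →
      ChainHom (Ban.map φ φ') (c.dsum c') (d.dsum d') (Ban.map α α') (Ban.map β β') := by
  induction c with
  | start f g inj exact =>
    intro C D A' B' C' D' g f' g' d c' d' α β α' β' h h'
    cases d with
    | snoc d _ _ => exact h.elim
    | start =>
      cases c' with
      | snoc c' _ _ => exact (c'.zero_false rfl).elim
      | start =>
        cases d' with
        | snoc c' _ _ => exact h'.elim
        | start =>
          exact ⟨fun y => Prod.ext (h.1 y.1) (h'.1 y.2), fun y => Prod.ext (h.2 y.1) (h'.2 y.2)⟩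
  | snoc c g exact ih =>
    intro C D A' B' C' D' g f' g' d c' d' α β α' β' h h'
    cases d with
    | start => exact h.elim
    | snoc d _ _ =>
      cases c' with
      | start => exact (c.zero_false rfl).elim
      | snoc c' _ _ =>
        cases d' with
        | start => exact h'.elim
        | snoc d' _ _ =>
          obtain ⟨⟨δ, hδ⟩, h⟩ := h
          obtain ⟨⟨δ', hδ'⟩, h'⟩ := h'
          exact ⟨⟨_, ih hδ hδ'⟩, fun y => Prod.ext (h y.1) (h' y.2)⟩

/-- The exact sequence `0 → Y → Y → 0 → ⋯ → 0 → C` with `n + 1` terms between `Y` and `C`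
and first arrow the identity. -/
def Chain.zero (Y : Ban.{u} 𝕜) : (n : ℕ) → (C : Ban.{u} 𝕜) →
    Σ A : Ban.{u} 𝕜, Chain Y (n + 1) (0 : A →L[𝕜] C)
  | 0, _ => ⟨Y, .start (.id 𝕜 Y) 0 Function.injective_id fun y => by simp⟩
  | n + 1, _ => ⟨Ban.zero 𝕜, .snoc (Chain.zero Y n (Ban.zero 𝕜)).2 0 fun y =>
      ⟨fun _ => ⟨0, Subsingleton.elim (α := PUnit) _ _⟩, fun _ => rfl⟩⟩

namespace NExact

/-- The pushout sequence `β S`. -/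
def push {n : ℕ} {X Y B : Ban.{u} 𝕜} (β : Y →L[𝕜] B) (S : NExact n X Y) : NExact n X B where
  π := (S.chain.push β).map
  chain := (S.chain.push β).chain
  surj := Set.range_eq_univ.1 ((S.chain.push β).range_eq.trans (Set.range_eq_univ.2 S.surj))

/-- The pullback sequence `S α`. -/
def pull {n : ℕ} {X Y A : Ban.{u} 𝕜} (S : NExact n X Y) (α : A →L[𝕜] X) : NExact n A Y where
  π := PB.snd S.π α
  chain := S.chain.pull α
  surj := fun a => by
    obtain ⟨e, he⟩ := S.surj (α a)
    exact ⟨⟨(e, a), (mem_pullbackSub _ _ _).2 he⟩, rfl⟩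

/-- The termwise direct sum of two `n`-exact sequences. -/
def dsum {n : ℕ} {X Y X' Y' : Ban.{u} 𝕜} (S : NExact n X Y) (T : NExact n X' Y') :
    NExact n (X.prod X') (Y.prod Y') where
  π := Ban.map S.π T.π
  chain := S.chain.dsum T.chain
  surj := Function.Surjective.prodMap S.surj T.surj

/-- The zero sequence: `0 → Y → Y ⊕ X → X → 0` for `n = 1`, and
`0 → Y = Y → 0 → ⋯ → 0 → X = X → 0` for `n ≥ 2`. -/
def zero : (n : ℕ) → (X Y : Ban.{u} 𝕜) → NExact (n + 1) X Y
  | 0, X, Y =>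
    { π := Ban.snd Y X
      chain := .start (Ban.inl Y X) (Ban.snd Y X) (LinearMap.inl_injective (R := 𝕜)) <| by
        rintro ⟨y, x⟩
        exact ⟨fun h => ⟨y, Prod.ext rfl (Eq.symm h)⟩, fun ⟨_, h⟩ => (congrArg Prod.snd h).symm⟩
      surj := Prod.snd_surjective }
  | n + 1, X, Y =>
    { π := .id 𝕜 X
      chain := .snoc (Chain.zero Y n X).2 (.id 𝕜 X) fun x =>
        ⟨fun h => ⟨0, by simpa using Eq.symm h⟩, fun ⟨_, h⟩ => by simpa using Eq.symm h⟩
      surj := Function.surjective_id }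

theorem Hom.push {n : ℕ} {X Y B : Ban.{u} 𝕜} (β : Y →L[𝕜] B) {S T : NExact n X Y}
    (h : Hom S T) : Hom (S.push β) (T.push β) :=
  let ⟨_, h⟩ := h
  ChainHom.push β _ h

theorem Hom.pull {n : ℕ} {X Y A : Ban.{u} 𝕜} {S T : NExact n X Y} (h : Hom S T)
    (α : A →L[𝕜] X) : Hom (S.pull α) (T.pull α) :=
  let ⟨_, h⟩ := h
  ChainHom.pull h α

theorem Hom.refl {n : ℕ} {X Y : Ban.{u} 𝕜} (S : NExact n X Y) : Hom S S :=
  ⟨_, ChainHom.id S.chain⟩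

theorem Hom.dsum {n : ℕ} {X Y X' Y' : Ban.{u} 𝕜} {S T : NExact n X Y} {S' T' : NExact n X' Y'}
    (h : Hom S T) (h' : Hom S' T') : Hom (S.dsum S') (T.dsum T') := by
  obtain ⟨α, h⟩ := h
  obtain ⟨α', h'⟩ := h'
  exact ⟨_, ChainHom.dsum _ h h'⟩

/-- The Baer sum `∇ (S ⊕ T) Δ` of two `n`-exact sequences with the same ends. -/
def baer {n : ℕ} {X Y : Ban.{u} 𝕜} (S T : NExact n X Y) : NExact n X Y :=
  ((S.dsum T).push Y.sum).pull X.diag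

theorem Hom.baer {n : ℕ} {X Y : Ban.{u} 𝕜} {S T S' T' : NExact n X Y}
    (h : Hom S T) (h' : Hom S' T') : Hom (S.baer S') (T.baer T') :=
  ((h.dsum h').push _).pull _

/-- Equivalence of `n`-exact sequences: there is a finite zigzag of morphisms which are the
identity at both ends. -/
def setoid (n : ℕ) (X Y : Ban.{u} 𝕜) : Setoid (NExact n X Y) :=
  Relation.EqvGen.setoid Hom

theorem setoid_map {n m : ℕ} {X Y X' Y' : Ban.{u} 𝕜} (F : NExact n X Y → NExact m X' Y')
    (hF : ∀ S T, Hom S T → Hom (F S) (F T)) {S T : NExact n X Y} (h : setoid n X Y S T) :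
    setoid m X' Y' (F S) (F T) := by
  induction h with
  | rel S T h => exact .rel _ _ (hF _ _ h)
  | refl S => exact .refl _
  | symm S T _ ih => exact .symm _ _ ih
  | trans S T U _ _ ih ih' => exact .trans _ _ _ ih ih'

end NExact

/-! ### The spaces `Extⁿ` -/

/-- `Extⁿ(X, Y)`, for `n ≥ 1`: equivalence classes of `n`-exact sequences between `Y` and `X`. -/
def Ext (n : ℕ) (X Y : Ban.{u} 𝕜) : Type (max (u + 1) v) :=
  Quotient (NExact.setoid n X Y)

namespace Ext

/-- The class of an `n`-exact sequence. -/
def mk {n : ℕ} {X Y : Ban.{u} 𝕜} (S : NExact n X Y) : Ext n X Y :=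
  Quotient.mk (NExact.setoid n X Y) S

/-- Addition: the Baer sum. -/
instance {n : ℕ} {X Y : Ban.{u} 𝕜} : Add (Ext n X Y) where
  add := Quotient.map₂ NExact.baer fun _ S' h T _ h' => Setoid.trans'
    (NExact.setoid n X Y)
    (NExact.setoid_map (fun U => U.baer T) (fun _ _ k => k.baer (.refl T)) h)
    (NExact.setoid_map (fun U => S'.baer U) (fun _ _ k => (NExact.Hom.refl S').baer k) h')

/-- Multiplication by a scalar `c`: pushout along `c • id`. -/
instance {n : ℕ} {X Y : Ban.{u} 𝕜} : SMul 𝕜 (Ext n X Y) where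
  smul c := Quotient.map (NExact.push (c • ContinuousLinearMap.id 𝕜 Y)) fun _ _ h =>
    NExact.setoid_map _ (fun _ _ k => k.push _) h

/-- The zero element of `Extⁿ(X, Y)`, for `n ≥ 1`. -/
instance {n : ℕ} {X Y : Ban.{u} 𝕜} : Zero (Ext (n + 1) X Y) where
  zero := mk (NExact.zero n X Y)

/-- Splicing with a fixed short exact sequence `0 → Z → F → X → 0`,
`Extⁿ(Z, Y) → Extⁿ⁺¹(X, Y)`. -/
def splice {n : ℕ} {X Y Z : Ban.{u} 𝕜} (P : ShortExact X Z) : Ext n Z Y → Ext (n + 1) X Y :=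
  Quotient.map (fun S => S.splice P) fun _ _ h => NExact.setoid_map _ (fun _ _ k => k.splice P) h

end Ext

/-- A bijection which preserves zero, addition and scalar multiplication. -/
structure IsLinearBijection (𝕜 : Type*) {V W : Type*} [Zero V] [Add V] [SMul 𝕜 V]
    [Zero W] [Add W] [SMul 𝕜 W] (F : V → W) : Prop where
  bijective : Function.Bijective F
  map_zero : F 0 = 0
  map_add : ∀ a b, F (a + b) = F a + F b
  map_smul : ∀ (c : 𝕜) a, F (c • a) = c • F a

/-! ### Projective presentations -/

/-- A Banach space is projective if operators defined on it lift through surjective operators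
between Banach spaces. -/
def IsProjective (P : Ban.{u} 𝕜) : Prop :=
  ∀ (E F : Ban.{u} 𝕜) (q : E →L[𝕜] F), Function.Surjective q →
    ∀ T : P →L[𝕜] F, ∃ T' : P →L[𝕜] E, q.comp T' = T

/-- A projective presentation `0 → κ(X) → 𝒫 → X → 0` of `X`. -/
structure ProjectivePresentation (X : Ban.{u} 𝕜) where
  κ : Ban.{u} 𝕜
  seq : ShortExact X κ
  projective : IsProjective seq.mid

/-- The iterated kernels `κ⁰(X) = X`, `κⁿ⁺¹(X) = κ(κⁿ(X))` with respect to a choice of a projective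
presentation of every Banach space. -/
def kappa (P : ∀ Z : Ban.{u} 𝕜, ProjectivePresentation Z) (X : Ban.{u} 𝕜) : ℕ → Ban.{u} 𝕜
  | 0 => X
  | n + 1 => (P (kappa P X n)).κ

/-- The presentation `0 → κⁿ⁺¹(X) → 𝒫ₙ₊₁ → κⁿ(X) → 0`. -/
def presentation (P : ∀ Z : Ban.{u} 𝕜, ProjectivePresentation Z) (X : Ban.{u} 𝕜) (n : ℕ) :
    ShortExact (kappa P X n) (kappa P X (n + 1)) :=
  (P (kappa P X n)).seq

/-- The restriction map `ι^* : 𝔏(E, Y) → 𝔏(K, Y)`, `T ↦ T ∘ ι`. -/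
def restriction {K E : Ban.{u} 𝕜} (ι : K →L[𝕜] E) (Y : Ban.{u} 𝕜) :
    (E →L[𝕜] Y) →ₗ[𝕜] (K →L[𝕜] Y) where
  toFun T := T.comp ι
  map_add' _ _ := rfl
  map_smul' _ _ := rfl

end BanachExt

end

open BanachExt

namespace BanachExt

variable {𝕜 : Type v} [RCLike 𝕜]

/-! ### Ladders with arbitrary ends -/

/-! The proof is dimension shifting along a projective presentation `0 → Z → 𝒫 → X → 0`.

Given `0 → Y → ⋯ → A → B → X → 0` of length at least 2, projectivity lifts `𝒫 → X` to `t : 𝒫 → B`.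
Its restriction to `Z` has values in the kernel of `B → X`, which is the range of `A → B`, so
pulling back `0 → Y → ⋯ → A → B` along this restriction gives an exact sequence ending in `Z` whose
splice maps to the given one (`NExact.exists_hom_splice`). Another lift differs from `t` by an
operator into that kernel, hence by one that lifts to `𝒫 → A`. Adding this correction to a ladder
shows that any two sequences whose splices map to the same target are equivalent
(`NExact.setoid_of_hom_splice`). So unsplicing respects zigzags and inverts splicing.

For length 1 the same lift restricts to an operator `Z → Y`, unique up to restrictions of operators
`𝒫 → Y` (`NExact.exists_mor_of_projective`, `NExact.sub_mem_range_of_mor`).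

Linearity is formal: pushouts and pullbacks are characterised by ladders with nonidentity ends
(`NExact.Mor`), so each identity of classes reduces to exhibiting a ladder. The right end of a
`Chain` need not be surjected onto, so ladders can be cut before their last term. -/

theorem ChainHom.comp {Y Y' Y'' : Ban.{u} 𝕜} {φ : Y →L[𝕜] Y'} {φ' : Y' →L[𝕜] Y''} {n : ℕ}
    {A B : Ban.{u} 𝕜} {f : A →L[𝕜] B} (c : Chain Y n f) :
    ∀ {A' B' A'' B'' : Ban.{u} 𝕜} {f' : A' →L[𝕜] B'} {f'' : A'' →L[𝕜] B''}
      {c' : Chain Y' n f'} {c'' : Chain Y'' n f''} {α : A →L[𝕜] A'} {β : B →L[𝕜] B'}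
      {α' : A' →L[𝕜] A''} {β' : B' →L[𝕜] B''},
      ChainHom φ c c' α β → ChainHom φ' c' c'' α' β' →
      ChainHom (φ'.comp φ) c c'' (α'.comp α) (β'.comp β) := by
  induction c with
  | start f g _ _ =>
    intro A' B' A'' B'' f' f'' c' c'' α β α' β' h h'
    cases c' with
    | snoc => exact h.elim
    | start =>
      cases c'' with
      | snoc => exact h'.elim
      | start =>
        exact ⟨fun y => (congrArg α' (h.1 y)).trans (h'.1 _),
          fun e => (congrArg β' (h.2 e)).trans (h'.2 _)⟩
  | snoc c g _ ih =>
    intro A' B' A'' B'' f' f'' c' c'' α β α' β' h h'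
    cases c' with
    | start => exact h.elim
    | snoc =>
      cases c'' with
      | start => exact h'.elim
      | snoc =>
        obtain ⟨⟨δ, hδ⟩, h⟩ := h
        obtain ⟨⟨δ', hδ'⟩, h'⟩ := h'
        exact ⟨⟨_, ih hδ hδ'⟩, fun e => (congrArg β' (h e)).trans (h' _)⟩

/-- Only the last square sees the last arrow. This strips the embedding that splicing composes into
the arrow at the joint, leaving a ladder out of the unspliced sequence. -/
theorem ChainHom.of_changeLast {Y Y' : Ban.{u} 𝕜} {φ : Y →L[𝕜] Y'} {n : ℕ}
    {A B C A' B' : Ban.{u} 𝕜} {f : A →L[𝕜] B} {f' : A' →L[𝕜] B'}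
    {c : Chain Y n f} {c' : Chain Y' n f'} {g : A →L[𝕜] C} {hg : ∀ a, g a = 0 ↔ f a = 0}
    {α : A →L[𝕜] A'} {β : C →L[𝕜] B'}
    (h : ChainHom φ (c.changeLast g hg) c' α β) (γ : B →L[𝕜] B')
    (hγ : ∀ a, γ (f a) = f' (α a)) : ChainHom φ c c' α γ := by
  cases c with
  | start =>
    cases c' with
    | start => exact ⟨h.1, hγ⟩
    | snoc => exact h.elim
  | snoc =>
    cases c' with
    | start => exact h.elim
    | snoc => exact ⟨h.1, hγ⟩

theorem ChainHom.changeLast_left {Y Y' : Ban.{u} 𝕜} {φ : Y →L[𝕜] Y'} {n : ℕ}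
    {A B C A' B' : Ban.{u} 𝕜} {f : A →L[𝕜] B} {f' : A' →L[𝕜] B'}
    {c : Chain Y n f} {c' : Chain Y' n f'} {α : A →L[𝕜] A'} {β : B →L[𝕜] B'}
    (h : ChainHom φ c c' α β) (g : A →L[𝕜] C) (hg : ∀ a, g a = 0 ↔ f a = 0) (γ : C →L[𝕜] B')
    (hγ : ∀ a, γ (g a) = f' (α a)) : ChainHom φ (c.changeLast g hg) c' α γ := by
  cases c with
  | start =>
    cases c' with
    | start => exact ⟨h.1, hγ⟩
    | snoc => exact h.elim
  | snoc =>
    cases c' with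
    | start => exact h.elim
    | snoc => exact ⟨h.1, hγ⟩

theorem ChainHom.changeLast_right {Y Y' : Ban.{u} 𝕜} {φ : Y →L[𝕜] Y'} {n : ℕ}
    {A B A' B' C' : Ban.{u} 𝕜} {f : A →L[𝕜] B} {f' : A' →L[𝕜] B'}
    {c : Chain Y n f} {c' : Chain Y' n f'} {α : A →L[𝕜] A'} {β : B →L[𝕜] B'}
    (h : ChainHom φ c c' α β) (g' : A' →L[𝕜] C') (hg' : ∀ a, g' a = 0 ↔ f' a = 0)
    (γ : B →L[𝕜] C') (hγ : ∀ a, γ (f a) = g' (α a)) :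
    ChainHom φ c (c'.changeLast g' hg') α γ := by
  cases c with
  | start =>
    cases c' with
    | start => exact ⟨h.1, hγ⟩
    | snoc => exact h.elim
  | snoc =>
    cases c' with
    | start => exact h.elim
    | snoc => exact ⟨h.1, hγ⟩

theorem ChainHom.replace_right {Y Y' : Ban.{u} 𝕜} {φ : Y →L[𝕜] Y'} {n : ℕ}
    {A B A' B' : Ban.{u} 𝕜} {f : A →L[𝕜] B} {f' : A' →L[𝕜] B'} {c : Chain Y n f}
    {c' : Chain Y' n f'} {α : A →L[𝕜] A'} {β : B →L[𝕜] B'} (h : ChainHom φ c c' α β)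
    (γ : B →L[𝕜] B') (hγ : ∀ a, γ (f a) = f' (α a)) : ChainHom φ c c' α γ := by
  cases c with
  | start =>
    cases c' with
    | start => exact ⟨h.1, hγ⟩
    | snoc => exact h.elim
  | snoc =>
    cases c' with
    | start => exact h.elim
    | snoc => exact ⟨h.1, hγ⟩

/-- A homotopy supported at the last step: `s.comp f` vanishes on the image of the preceding arrow
by exactness, so everything further left is undisturbed while the right end moves by `f'` composed
with `s`. -/
theorem ChainHom.add_right {Y Y' : Ban.{u} 𝕜} {φ : Y →L[𝕜] Y'} {n : ℕ}
    {A B A' B' : Ban.{u} 𝕜} {f : A →L[𝕜] B} {f' : A' →L[𝕜] B'} {c : Chain Y n f}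
    {c' : Chain Y' n f'} {α : A →L[𝕜] A'} {β : B →L[𝕜] B'} (h : ChainHom φ c c' α β)
    (s : B →L[𝕜] A') (γ : B →L[𝕜] B') (hγ : ∀ b, γ b = β b + f' (s b)) :
    ChainHom φ c c' (α + s.comp f) γ := by
  have hl : ∀ a, γ (f a) = f' ((α + s.comp f) a) := fun a => by simp [hγ, h.last]
  cases c with
  | start f g _ hfg =>
    cases c' with
    | snoc => exact h.elim
    | start =>
      refine ⟨fun y => ?_, hl⟩
      simp [(hfg _).2 ⟨y, rfl⟩, h.1 y]
  | snoc c _ hfg =>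
    cases c' with
    | start => exact h.elim
    | snoc =>
      obtain ⟨⟨δ, hδ⟩, h⟩ := h
      exact ⟨⟨δ, hδ.replace_right _ fun a => by simp [(hfg _).2 ⟨a, rfl⟩, hδ.last a]⟩, hl⟩

theorem ChainHom.pull_fst {Y : Ban.{u} 𝕜} {n : ℕ} {E X A : Ban.{u} 𝕜} {f : E →L[𝕜] X}
    (c : Chain Y n f) (α : A →L[𝕜] X) :
    ChainHom (.id 𝕜 Y) (c.pull α) c (PB.fst f α) α := by
  cases c with
  | start => exact ⟨fun _ => rfl, fun z => (PB.condition _ _ z).symm⟩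
  | snoc c =>
    exact ⟨⟨_, (ChainHom.id c).changeLast_left _ _ _ fun _ => rfl⟩,
      fun z => (PB.condition _ _ z).symm⟩

/-- Universal property of the pullback for ladders. The new component `γ.comp f` kills the image of
the preceding arrow, as the arrow into the pullback, whose second component is zero, requires. -/
theorem ChainHom.lift_pull {Y Y' : Ban.{u} 𝕜} {φ : Y →L[𝕜] Y'} {n : ℕ}
    {E X E' X' A : Ban.{u} 𝕜} {f : E →L[𝕜] X} {f' : E' →L[𝕜] X'} {c : Chain Y n f}
    {c' : Chain Y' n f'} {a : E →L[𝕜] E'} {β : X →L[𝕜] X'} (h : ChainHom φ c c' a β)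
    (γ : X →L[𝕜] A) (α : A →L[𝕜] X') (hαγ : ∀ x, β x = α (γ x)) :
    ChainHom φ c (c'.pull α) (PB.lift a (γ.comp f) fun e => by
      rw [← h.last, hαγ]; rfl) γ := by
  cases c with
  | start f g _ hfg =>
    cases c' with
    | snoc => exact h.elim
    | start =>
      refine ⟨fun y => PB.ext (h.1 y) ?_, fun _ => rfl⟩
      exact (congrArg γ ((hfg _).2 ⟨y, rfl⟩)).trans (map_zero γ)
  | snoc c g hfg =>
    cases c' with
    | start => exact h.elim
    | snoc =>
      obtain ⟨⟨δ, hδ⟩, h⟩ := h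
      refine ⟨⟨δ, hδ.changeLast_right _ _ _ fun b => PB.ext (hδ.last b) ?_⟩, fun _ => rfl⟩
      exact (congrArg γ ((hfg _).2 ⟨b, rfl⟩)).trans (map_zero γ)

theorem ChainHom.to_push {Y B : Ban.{u} 𝕜} (β : Y →L[𝕜] B) {n : ℕ} {A C : Ban.{u} 𝕜}
    {f : A →L[𝕜] C} (c : Chain Y n f) :
    ∃ α, ChainHom β c (c.push β).chain α (.id 𝕜 C) := by
  induction c with
  | start f g _ hfg =>
    exact ⟨PO.inl f β, fun y => PO.condition f β y, fun e =>
      (PO.desc_inl g 0 (fun y => (hfg (f y)).2 ⟨y, rfl⟩) e).symm⟩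
  | snoc c g _ ih => exact ⟨.id 𝕜 _, ih, fun _ => rfl⟩

/-- Universal property of the pushout for ladders. Only the first term changes, so the induction
carries the descended operator from the left end and keeps all later operators. -/
theorem ChainHom.push_desc {Y B : Ban.{u} 𝕜} {β : Y →L[𝕜] B} {n : ℕ} {A C : Ban.{u} 𝕜}
    {f : A →L[𝕜] C} (c : Chain Y n f) : ∀ {A' C' : Ban.{u} 𝕜} {f' : A' →L[𝕜] C'}
    {c' : Chain B n f'} {α : A →L[𝕜] A'} {γ : C →L[𝕜] C'}, ChainHom β c c' α γ →
    ∃ α', ChainHom (.id 𝕜 B) (c.push β).chain c' α' γ := by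
  induction c with
  | start f g inj hfg =>
    intro A' C' g' c' α γ h
    cases c' with
    | snoc => exact h.elim
    | start f' _ _ hfg' =>
      obtain ⟨h₁, h₂⟩ := h
      refine ⟨PO.desc α f' h₁, fun b => PO.desc_inr _ _ _ b, fun z => ?_⟩
      obtain ⟨a, b, rfl⟩ := PO.exists_rep z
      have e : γ (PO.desc g 0 (fun y => (hfg (f y)).2 ⟨y, rfl⟩) (PO.inl f β a + PO.inr f β b)) =
          g' (PO.desc α f' h₁ (PO.inl f β a + PO.inr f β b)) := by
        rw [map_add, map_add, map_add, PO.desc_inl, PO.desc_inr, PO.desc_inl, PO.desc_inr, map_add, h₂ a,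
          (hfg' _).2 ⟨b, rfl⟩]
        simp
      exact e
  | snoc c g _ ih =>
    intro A' C' g' c' α γ h
    cases c' with
    | start => exact h.elim
    | snoc =>
      obtain ⟨⟨δ, hδ⟩, h⟩ := h
      exact ⟨α, ih hδ, h⟩

/-- Both sequences have the same spaces and differ only in how the last arrow is written. The case
split is needed for `Chain.dsum` to reduce. -/
theorem ChainHom.dsum_changeLast {Y Y' : Ban.{u} 𝕜} {n : ℕ} {A B C A' B' C' : Ban.{u} 𝕜}
    {f : A →L[𝕜] B} {f' : A' →L[𝕜] B'} (c : Chain Y n f) (c' : Chain Y' n f')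
    (g : A →L[𝕜] C) (hg : ∀ a, g a = 0 ↔ f a = 0) (g' : A' →L[𝕜] C')
    (hg' : ∀ a, g' a = 0 ↔ f' a = 0) (h : A.prod A' →L[𝕜] C.prod C')
    (hh : ∀ a, h a = 0 ↔ Ban.map f f' a = 0) (e : ∀ a, Ban.map g g' a = h a) :
    ChainHom (.id 𝕜 _) ((c.changeLast g hg).dsum (c'.changeLast g' hg'))
      ((c.dsum c').changeLast h hh) (.id 𝕜 _) (.id 𝕜 _) := by
  cases c with
  | start =>
    cases c' with
    | snoc c' => exact (c'.zero_false rfl).elim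
    | start => exact ⟨fun _ => rfl, e⟩
  | snoc c =>
    cases c' with
    | start => exact (c.zero_false rfl).elim
    | snoc c' => exact ⟨⟨_, ChainHom.id _⟩, e⟩

theorem ChainHom.zero (Y : Ban.{u} 𝕜) (n : ℕ) {C C' : Ban.{u} 𝕜} (β : C →L[𝕜] C') :
    ∃ α, ChainHom (.id 𝕜 Y) (Chain.zero Y n C).2 (Chain.zero Y n C').2 α β := by
  cases n with
  | zero => exact ⟨.id 𝕜 Y, fun _ => rfl, fun _ => map_zero β⟩
  | succ n => exact ⟨.id 𝕜 _, ⟨_, ChainHom.id _⟩, fun _ => map_zero β⟩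

/-- The direct sum of two short exact sequences. -/
def ShortExact.prod {X Y X' Y' : Ban.{u} 𝕜} (P : ShortExact X Y) (Q : ShortExact X' Y') :
    ShortExact (X.prod X') (Y.prod Y') where
  mid := P.mid.prod Q.mid
  ι := Ban.map P.ι Q.ι
  π := Ban.map P.π Q.π
  inj := P.inj.prodMap Q.inj
  exact := exact_map P.exact Q.exact
  surj := P.surj.prodMap Q.surj

/-! ### Morphisms with arbitrary ends, and compatibility of splicing with the linear structure. -/

namespace NExact

/-- There is a morphism `S ⟶ T` with the operators `φ` and `α` at the ends. -/
def Mor {n : ℕ} {X Y X' Y' : Ban.{u} 𝕜} (φ : Y →L[𝕜] Y') (α : X →L[𝕜] X')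
    (S : NExact n X Y) (T : NExact n X' Y') : Prop :=
  ∃ a : S.last →L[𝕜] T.last, ChainHom φ S.chain T.chain a α

theorem Mor.comp {n : ℕ} {X Y X' Y' X'' Y'' : Ban.{u} 𝕜} {φ : Y →L[𝕜] Y'} {α : X →L[𝕜] X'}
    {φ' : Y' →L[𝕜] Y''} {α' : X' →L[𝕜] X''} {S : NExact n X Y} {T : NExact n X' Y'}
    {U : NExact n X'' Y''} (h : Mor φ α S T) (h' : Mor φ' α' T U) :
    Mor (φ'.comp φ) (α'.comp α) S U :=
  let ⟨_, h⟩ := h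
  let ⟨_, h'⟩ := h'
  ⟨_, ChainHom.comp _ h h'⟩

theorem Hom.trans {n : ℕ} {X Y : Ban.{u} 𝕜} {S T U : NExact n X Y} (h : Hom S T)
    (h' : Hom T U) : Hom S U :=
  Mor.comp h h'

theorem Mor.dsum {n : ℕ} {X Y X' Y' Z W Z' W' : Ban.{u} 𝕜} {φ : Y →L[𝕜] Y'} {α : X →L[𝕜] X'}
    {ψ : W →L[𝕜] W'} {β : Z →L[𝕜] Z'} {S : NExact n X Y} {T : NExact n X' Y'}
    {S' : NExact n Z W} {T' : NExact n Z' W'} (h : Mor φ α S T) (h' : Mor ψ β S' T') :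
    Mor (Ban.map φ ψ) (Ban.map α β) (S.dsum S') (T.dsum T') :=
  let ⟨_, h⟩ := h
  let ⟨_, h'⟩ := h'
  ⟨_, ChainHom.dsum _ h h'⟩

theorem mor_push {n : ℕ} {X Y B : Ban.{u} 𝕜} (β : Y →L[𝕜] B) (S : NExact n X Y) :
    Mor β (.id 𝕜 X) S (S.push β) :=
  ChainHom.to_push β S.chain

theorem Mor.push_desc {n : ℕ} {X X' Y B : Ban.{u} 𝕜} {β : Y →L[𝕜] B} {α : X →L[𝕜] X'}
    {S : NExact n X Y} {T : NExact n X' B} (h : Mor β α S T) :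
    Mor (.id 𝕜 B) α (S.push β) T :=
  let ⟨_, h⟩ := h
  ChainHom.push_desc _ h

theorem mor_pull {n : ℕ} {X Y A : Ban.{u} 𝕜} (S : NExact n X Y) (α : A →L[𝕜] X) :
    Mor (.id 𝕜 Y) α (S.pull α) S :=
  ⟨_, ChainHom.pull_fst S.chain α⟩

theorem Mor.lift_pull {n : ℕ} {X Y Y' A : Ban.{u} 𝕜} {φ : Y →L[𝕜] Y'} {α : A →L[𝕜] X}
    {S : NExact n A Y} {T : NExact n X Y'} (h : Mor φ α S T) :
    Mor φ (.id 𝕜 A) S (T.pull α) :=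
  let ⟨_, h⟩ := h
  ⟨_, h.lift_pull (.id 𝕜 A) α fun _ => rfl⟩

theorem Mor.splice {n : ℕ} {X Y Z X' Y' Z' : Ban.{u} 𝕜} {φ : Y →L[𝕜] Y'} {α : Z →L[𝕜] Z'}
    {S : NExact n Z Y} {T : NExact n Z' Y'} (h : Mor φ α S T) (P : ShortExact X Z)
    (Q : ShortExact X' Z') (b : P.mid →L[𝕜] Q.mid) (γ : X →L[𝕜] X')
    (hb : ∀ z, b (P.ι z) = Q.ι (α z)) (hγ : ∀ e, γ (P.π e) = Q.π (b e)) :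
    Mor φ γ (S.splice P) (T.splice Q) := by
  obtain ⟨a, h⟩ := h
  exact ⟨b, ⟨a, h.changeLast _ _ _ _ _ fun e =>
    (hb _).trans (congrArg Q.ι (h.last e))⟩, hγ⟩

theorem hom_dsum_splice {n : ℕ} {X Y Z X' Y' Z' : Ban.{u} 𝕜} (S : NExact n Z Y)
    (T : NExact n Z' Y') (P : ShortExact X Z) (Q : ShortExact X' Z') :
    Hom ((S.splice P).dsum (T.splice Q)) ((S.dsum T).splice (P.prod Q)) :=
  ⟨.id 𝕜 _, ⟨.id 𝕜 _, ChainHom.dsum_changeLast _ _ _ _ _ _ _ _ fun _ => rfl⟩, fun _ => rfl⟩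

/-- The ladder collapses the middle term of `P` onto `X`. -/
theorem hom_zero_splice {n : ℕ} {X Y Z : Ban.{u} 𝕜} (P : ShortExact X Z) :
    Hom ((zero n Z Y).splice P) (zero (n + 1) X Y) := by
  have hP : ∀ z, P.π (P.ι z) = 0 := fun z => (P.exact _).2 ⟨z, rfl⟩
  cases n with
  -- The length-one zero sequence is the split one, so its middle term `Y ⊕ Z` is projected onto
  -- `Y`; in greater length the term `Z` is sent to the zero space.
  | zero => exact ⟨P.π, ⟨Ban.fst Y Z, fun _ => rfl, fun e => hP e.2⟩, fun _ => rfl⟩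
  | succ n => exact ⟨P.π, ⟨0, ChainHom.zero Y n 0, fun e => hP e⟩, fun _ => rfl⟩

theorem hom_smul_splice {n : ℕ} {X Y B Z : Ban.{u} 𝕜} (β : Y →L[𝕜] B) (S : NExact n Z Y)
    (P : ShortExact X Z) : Hom ((S.splice P).push β) ((S.push β).splice P) :=
  ((mor_push β S).splice P P (.id 𝕜 _) (.id 𝕜 _) (fun _ => rfl) fun _ => rfl).push_desc

/-- Both sides map to the splice of `∇(S ⊕ T)` with `P ⊕ P`, pulled back along the diagonal of `X`.
The diagonals of `Z`, `P.mid` and `X` form a morphism from `P` to `P ⊕ P`, which gives the left-hand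
map. -/
theorem setoid_baer_splice {n : ℕ} {X Y Z : Ban.{u} 𝕜} (S T : NExact n Z Y)
    (P : ShortExact X Z) :
    setoid _ X Y ((S.baer T).splice P) ((S.splice P).baer (T.splice P)) := by
  have h₁ : Hom (((S.splice P).dsum (T.splice P)).push Y.sum)
      (((S.dsum T).push Y.sum).splice (P.prod P)) :=
    Mor.push_desc <| Mor.comp (hom_dsum_splice S T P P) <|
      (mor_push Y.sum (S.dsum T)).splice (P.prod P) (P.prod P) (.id 𝕜 _) (.id 𝕜 _)
        (fun _ => rfl) fun _ => rfl
  have h₂ : Hom ((S.baer T).splice P)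
      ((((S.dsum T).push Y.sum).splice (P.prod P)).pull X.diag) :=
    Mor.lift_pull <| (mor_pull ((S.dsum T).push Y.sum) Z.diag).splice P (P.prod P) P.mid.diag
      X.diag (fun _ => rfl) fun _ => rfl
  exact .trans _ _ _ (.rel _ _ h₂) (.symm _ _ (.rel _ _ (h₁.pull X.diag)))

/-! ### Splicing with a projective presentation -/

/-- If `Q` is projective, an operator from `Q` with values in the range of `f`, which is the
kernel of an operator, lifts through `f`. -/
theorem _root_.BanachExt.IsProjective.lift_of_exact {Q A B C : Ban.{u} 𝕜} (hQ : IsProjective Q)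
    {f : A →L[𝕜] B} {g : B →L[𝕜] C} (hfg : Function.Exact f g) (t : Q →L[𝕜] B)
    (ht : ∀ x, g (t x) = 0) : ∃ s : Q →L[𝕜] A, ∀ x, f (s x) = t x := by
  have : CompleteSpace (LinearMap.ker g.toLinearMap) :=
    (ContinuousLinearMap.isClosed_ker g).completeSpace_coe
  obtain ⟨s, hs⟩ := hQ A ⟨LinearMap.ker g.toLinearMap⟩
    (f.codRestrict (LinearMap.ker g.toLinearMap) fun a => (hfg _).2 ⟨a, rfl⟩)
    (fun b => by
      obtain ⟨a, ha⟩ := (hfg b.1).1 b.2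
      exact ⟨a, Subtype.ext ha⟩)
    (t.codRestrict (LinearMap.ker g.toLinearMap) ht)
  exact ⟨s, fun x => congrArg Subtype.val (DFunLike.congr_fun hs x)⟩

/-- An operator with values in the range of an injective `f`, which is the kernel of an operator,
factors through `f`. -/
theorem _root_.BanachExt.exists_lift_of_exact {Q A B C : Ban.{u} 𝕜} {f : A →L[𝕜] B}
    {g : B →L[𝕜] C} (hf : Function.Injective f) (hfg : Function.Exact f g) (t : Q →L[𝕜] B)
    (ht : ∀ x, g (t x) = 0) : ∃ s : Q →L[𝕜] A, ∀ x, f (s x) = t x := by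
  have hr : ∀ x, t x ∈ LinearMap.range f.toLinearMap := fun x => (hfg _).1 (ht x)
  have hcl : IsClosed (Set.range f) := by
    rw [show Set.range f = g ⁻¹' {0} from Set.ext fun x => (hfg x).symm]
    exact isClosed_singleton.preimage g.continuous
  -- By the open mapping theorem, `f` is an isomorphism onto its closed range.
  let e := f.equivRange hf hcl
  refine ⟨e.symm.toContinuousLinearMap.comp (t.codRestrict _ hr), fun x => ?_⟩
  exact congrArg Subtype.val (e.apply_symm_apply ⟨t x, hr x⟩)

/-- Surjectivity of splicing: lift `P.π` to `t` through the last arrow, then pull the remaining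
sequence back along `t.comp P.ι`. -/
theorem exists_hom_splice {n : ℕ} {X Y Z : Ban.{u} 𝕜} (P : ShortExact X Z)
    (hP : IsProjective P.mid) (S : NExact (n + 1 + 1) X Y) :
    ∃ T : NExact (n + 1) Z Y, Hom (T.splice P) S := by
  obtain ⟨q, c, surj⟩ := S
  obtain ⟨t, ht⟩ := hP _ _ q surj P.π
  have ht' : ∀ e, q (t e) = P.π e := fun e => DFunLike.congr_fun ht e
  cases c with
  | snoc c _ hq =>
    -- The pulled-back arrow is onto `Z` because `q` kills `t (P.ι z)`, which therefore lies in the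
    -- range of the last arrow of `c`.
    let T : NExact (n + 1) Z Y := ⟨_, c.pull (t.comp P.ι), fun z => by
      obtain ⟨a, ha⟩ := (hq (t (P.ι z))).1 (by rw [ht']; exact (P.exact _).2 ⟨z, rfl⟩)
      exact ⟨⟨(a, z), (mem_pullbackSub _ _ _).2 ha⟩, rfl⟩⟩
    exact ⟨T, t, ⟨_, (ChainHom.pull_fst c (t.comp P.ι)).changeLast_left _ _ _ fun e =>
      (PB.condition _ _ e).symm⟩, fun e => (ht' e).symm⟩

/-- Injectivity of splicing: after correcting one ladder by a homotopy, `T` and `T'` both map to the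
same pullback of the truncated `S`. -/
theorem setoid_of_hom_splice {n : ℕ} {X Y Z : Ban.{u} 𝕜} (P : ShortExact X Z)
    (hP : IsProjective P.mid) (S : NExact (n + 1 + 1) X Y) {T T' : NExact (n + 1) Z Y}
    (h : Hom (T.splice P) S) (h' : Hom (T'.splice P) S) : setoid _ Z Y T T' := by
  obtain ⟨q, c, surj⟩ := S
  cases c with
  | snoc c _ hq =>
    obtain ⟨(t : P.mid →L[𝕜] _), ⟨a, h⟩, (ht : ∀ e, P.π e = q (t e))⟩ := h
    obtain ⟨(t' : P.mid →L[𝕜] _), ⟨a', h'⟩, (ht' : ∀ e, P.π e = q (t' e))⟩ := h'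
    obtain ⟨s, hs⟩ := hP.lift_of_exact hq (t' - t) fun x => by simp [← ht, ← ht']
    -- The homotopy moves the right end from `t.comp P.ι` to `t'.comp P.ι`, so that both ladders lie
    -- over the same operator.
    have k := (h.of_changeLast (t.comp P.ι) h.last).add_right (s.comp P.ι) (t'.comp P.ι)
      fun b => by simp [hs]
    have k' := h'.of_changeLast (t'.comp P.ι) h'.last
    have l := k.lift_pull (.id 𝕜 Z) (t'.comp P.ι) fun _ => rfl
    have l' := k'.lift_pull (.id 𝕜 Z) (t'.comp P.ι) fun _ => rfl
    let U : NExact (n + 1) Z Y := ⟨_, c.pull (t'.comp P.ι), fun z => by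
      -- Surjectivity onto `Z` is inherited from `T` through the ladder `l`.
      obtain ⟨e, rfl⟩ := T.surj z
      exact ⟨_, (l.last e).symm⟩⟩
    have hU : Hom T U := ⟨_, l⟩
    have hU' : Hom T' U := ⟨_, l'⟩
    exact .trans _ _ _ (.rel _ _ hU) (.symm _ _ (.rel _ _ hU'))

/-! ### Extensions and operators on the kernel of a projective presentation -/

theorem exists_mor_of_projective {X Y Z : Ban.{u} 𝕜} (P : ShortExact X Z)
    (hP : IsProjective P.mid) (S : NExact 1 X Y) :
    ∃ u : Z →L[𝕜] Y, Mor u (.id 𝕜 X) P.toNExact S := by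
  obtain ⟨q, c, surj⟩ := S
  obtain ⟨t, ht⟩ := hP _ _ q surj P.π
  have ht' : ∀ e, q (t e) = P.π e := fun e => DFunLike.congr_fun ht e
  cases c with
  | start f _ inj hq =>
    obtain ⟨u, hu⟩ := exists_lift_of_exact inj hq (t.comp P.ι) fun z =>
      (ht' _).trans ((P.exact _).2 ⟨z, rfl⟩)
    exact ⟨u, t, fun z => (hu z).symm, fun e => (ht' e).symm⟩
  | snoc c => exact (c.zero_false rfl).elim

/-- The two middle operators differ by one into the kernel of `q`, which is the copy of `Y`; that
difference, read in `Y`, extends `u - u'` to `P.mid`. -/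
theorem sub_mem_range_of_mor {X Y Z : Ban.{u} 𝕜} (P : ShortExact X Z) (S : NExact 1 X Y)
    {u u' : Z →L[𝕜] Y} (h : Mor u (.id 𝕜 X) P.toNExact S)
    (h' : Mor u' (.id 𝕜 X) P.toNExact S) : u - u' ∈ LinearMap.range (restriction P.ι Y) := by
  obtain ⟨q, c, surj⟩ := S
  cases c with
  | start f _ inj hq =>
    obtain ⟨(t : P.mid →L[𝕜] _), (h : ∀ z, t (P.ι z) = f (u z)), (ht : ∀ e, P.π e = q (t e))⟩ := h
    obtain ⟨(t' : P.mid →L[𝕜] _), (h' : ∀ z, t' (P.ι z) = f (u' z)),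
      (ht' : ∀ e, P.π e = q (t' e))⟩ := h'
    obtain ⟨s, hs⟩ := exists_lift_of_exact inj hq (t - t') fun x => by simp [← ht, ← ht']
    refine ⟨s, ContinuousLinearMap.ext fun z => inj ?_⟩
    change f (s (P.ι z)) = f (u z - u' z)
    rw [hs, map_sub, ← h, ← h']
    rfl
  | snoc c => exact (c.zero_false rfl).elim

/-- Adding `s`, followed by the inclusion of `Y`, to the canonical operator into the pushout changes
the left end by `s.comp P.ι` and leaves the right end alone. Hence the pushout class depends only on
`u` modulo restrictions. -/
theorem mor_push_add {X Y Z : Ban.{u} 𝕜} (P : ShortExact X Z) (u : Z →L[𝕜] Y)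
    (s : P.mid →L[𝕜] Y) : Mor (u + s.comp P.ι) (.id 𝕜 X) P.toNExact (P.toNExact.push u) := by
  have hP : ∀ y, P.π (P.ι y) = (0 : Y →L[𝕜] X) (u y) := fun y => (P.exact _).2 ⟨y, rfl⟩
  refine ⟨PO.inl P.ι u + (PO.inr P.ι u).comp s, fun z => ?_, fun (e : P.mid) => ?_⟩
  · change PO.inl P.ι u (P.ι z) + PO.inr P.ι u (s (P.ι z)) = PO.inr P.ι u (u z + s (P.ι z))
    rw [PO.condition, map_add]
  · change P.π e = PO.desc P.π 0 hP (PO.inl P.ι u e + PO.inr P.ι u (s e))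
    rw [map_add, PO.desc_inl, PO.desc_inr]
    simp

theorem mor_zero {X Y Z : Ban.{u} 𝕜} (P : ShortExact X Z) :
    Mor 0 (.id 𝕜 X) P.toNExact (zero 0 X Y) :=
  ⟨(0 : P.mid →L[𝕜] Y).prod P.π, fun z => Prod.ext rfl ((P.exact _).2 ⟨z, rfl⟩), fun _ => rfl⟩

/-- The sum `u + u'` is `∇ (u ⊕ u') Δ`, and each factor is the left end of a ladder; the pullback
then absorbs the diagonal on the right. -/
theorem Mor.baer {X Y Z : Ban.{u} 𝕜} {P : ShortExact X Z} {S T : NExact 1 X Y}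
    {u u' : Z →L[𝕜] Y} (h : Mor u (.id 𝕜 X) P.toNExact S)
    (h' : Mor u' (.id 𝕜 X) P.toNExact T) : Mor (u + u') (.id 𝕜 X) P.toNExact (S.baer T) := by
  have d : Mor Z.diag X.diag P.toNExact (P.toNExact.dsum P.toNExact) :=
    ⟨P.mid.diag, fun _ => rfl, fun _ => rfl⟩
  exact ((d.comp (h.dsum h')).comp (mor_push Y.sum _)).lift_pull

end NExact

/-! ### Passage to equivalence classes. -/

namespace Ext

theorem mk_eq_of_hom {n : ℕ} {X Y : Ban.{u} 𝕜} {S T : NExact n X Y} (h : NExact.Hom S T) :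
    mk S = mk T :=
  Quotient.sound (.rel _ _ h)

/-- Splicing with a projective presentation is a linear bijection. -/
theorem isLinearBijection_splice {n : ℕ} {X Y Z : Ban.{u} 𝕜} (P : ShortExact X Z)
    (hP : IsProjective P.mid) :
    IsLinearBijection 𝕜 (Ext.splice P : Ext (n + 1) Z Y → Ext (n + 1 + 1) X Y) where
  bijective := by
    choose R hR using NExact.exists_hom_splice (n := n) (Y := Y) P hP
    have hc : ∀ S S', NExact.setoid (n + 1 + 1) X Y S S' → mk (R S) = mk (R S') := by
      intro S S' h
      induction h with
      | rel S S' h =>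
        -- Along a morphism from `S` to `S'`, the splices of `R S` and of `R S'` both map to `S'`.
        exact Quotient.sound (NExact.setoid_of_hom_splice P hP S' ((hR S).trans h) (hR S'))
      | refl => rfl
      | symm _ _ _ ih => exact ih.symm
      | trans _ _ _ _ _ ih ih' => exact ih.trans ih'
    refine Function.bijective_iff_has_inverse.2
      ⟨Quotient.lift (fun S => mk (R S)) hc, fun T => ?_, fun S => ?_⟩
    · induction T using Quotient.inductionOn with
      | h T => exact Quotient.sound (NExact.setoid_of_hom_splice P hP _ (hR _) (.refl _))
    · induction S using Quotient.inductionOn with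
      | h S => exact mk_eq_of_hom (hR S)
  map_zero := mk_eq_of_hom (NExact.hom_zero_splice P)
  map_add a b := by
    induction a, b using Quotient.inductionOn₂ with
    | h S T => exact Quotient.sound (NExact.setoid_baer_splice S T P)
  map_smul c a := by
    induction a using Quotient.inductionOn with
    | h S => exact (mk_eq_of_hom (NExact.hom_smul_splice _ S P)).symm

/-- A ladder with ends `u` and the identity determines the class of its target. Linearity of
`ofQuotient` is checked by exhibiting such ladders. -/
theorem mk_push_eq_of_mor {n : ℕ} {X Y Z : Ban.{u} 𝕜} {S : NExact n X Z} {T : NExact n X Y}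
    {u : Z →L[𝕜] Y} (h : NExact.Mor u (.id 𝕜 X) S T) : mk (S.push u) = mk T :=
  mk_eq_of_hom h.push_desc

/-- The operator sending the class of `u` to the class of the pushout along `u`. -/
noncomputable def ofQuotient {X Z : Ban.{u} 𝕜} (P : ShortExact X Z) (Y : Ban.{u} 𝕜) :
    ((Z →L[𝕜] Y) ⧸ LinearMap.range (restriction P.ι Y)) → Ext 1 X Y :=
  Quotient.lift (fun u => mk (P.toNExact.push u)) fun u u' h => by
    obtain ⟨s, hs⟩ := (Submodule.quotientRel_def _).1 h
    have hs : s.comp P.ι = u - u' := hs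
    have := NExact.mor_push_add P u' s
    rw [hs, add_sub_cancel] at this
    exact mk_push_eq_of_mor this

/-- `Ext¹` is the quotient of the operators on the kernel of a projective presentation. -/
theorem isLinearBijection_ofQuotient {X Y Z : Ban.{u} 𝕜} (P : ShortExact X Z)
    (hP : IsProjective P.mid) : IsLinearBijection 𝕜 (ofQuotient P Y) where
  bijective := by
    choose R hR using NExact.exists_mor_of_projective (Y := Y) P hP
    have hc : ∀ S S', NExact.setoid 1 X Y S S' →
        (Submodule.Quotient.mk (R S) : _ ⧸ LinearMap.range (restriction P.ι Y)) =
          Submodule.Quotient.mk (R S') := by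
      intro S S' h
      induction h with
      | rel S S' h =>
        exact (Submodule.Quotient.eq _).2
          (NExact.sub_mem_range_of_mor P S' ((hR S).comp h) (hR S'))
      | refl => rfl
      | symm _ _ _ ih => exact ih.symm
      | trans _ _ _ _ _ ih ih' => exact ih.trans ih'
    refine Function.bijective_iff_has_inverse.2 ⟨Quotient.lift _ hc, fun u => ?_, fun S => ?_⟩
    · induction u using Submodule.Quotient.induction_on with
      | H u =>
        exact (Submodule.Quotient.eq (LinearMap.range (restriction P.ι Y))).2
          (NExact.sub_mem_range_of_mor P _ (hR _) (NExact.mor_push u P.toNExact))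
    · induction S using Quotient.inductionOn with
      | h S => exact mk_push_eq_of_mor (hR S)
  map_zero := mk_push_eq_of_mor (NExact.mor_zero P)
  map_add a b := by
    induction a using Submodule.Quotient.induction_on with
    | H u =>
      induction b using Submodule.Quotient.induction_on with
      | H u' =>
        exact mk_push_eq_of_mor
          ((NExact.mor_push u P.toNExact).baer (NExact.mor_push u' P.toNExact))
  map_smul c a := by
    induction a using Submodule.Quotient.induction_on with
    | H u => exact mk_push_eq_of_mor ((NExact.mor_push u P.toNExact).comp (NExact.mor_push _ _))

end Ext

end BanachExt

/-- The variable `n` is one less than the degree of `Ext`, so `presentation P X n` is the last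
presentation used, and `m + 1` is the degree before splicing. -/
theorem mainTheorem6 {𝕜 : Type v} [RCLike 𝕜]
    (P : ∀ Z : Ban.{u} 𝕜, ProjectivePresentation Z) (X Y : Ban.{u} 𝕜) (n : ℕ) :
    (∀ k m : ℕ, k + m + 1 = n →
      IsLinearBijection 𝕜
        (Ext.splice (presentation P X k) :
          Ext (m + 1) (kappa P X (k + 1)) Y → Ext (m + 2) (kappa P X k) Y)) ∧
    ∃ Φ : ((kappa P X (n + 1) →L[𝕜] Y) ⧸
          LinearMap.range (restriction (presentation P X n).ι Y)) →
        Ext 1 (kappa P X n) Y,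
      IsLinearBijection 𝕜 Φ ∧
      ∀ u : kappa P X (n + 1) →L[𝕜] Y,
        Φ (Submodule.Quotient.mk u) =
          Ext.mk ((presentation P X n).toNExact.push u) := by
  refine ⟨fun k m _ => Ext.isLinearBijection_splice _ (P _).projective, ?_⟩
  exact ⟨Ext.ofQuotient (presentation P X n) Y,
    Ext.isLinearBijection_ofQuotient _ (P _).projective, fun _ => rfl⟩
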